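/- Let $\mathcal{G}$ be a nonabelian group of order $pq$, where $p<q$ are primes, and let $\alpha\in[0,1]$. Let $\mathcal{P}(\mathcal{G})$ be its power graph: the simple graph with vertex set $\mathcal{G}$ in which two distinct elements are adjacent if and only if one of them is a positive power of the other. For a finite simple graph $\Gamma$ put $A_\alpha(\Gamma)=\alpha D(\Gamma)+(1-\alpha)A(\Gamma)$, where $A(\Gamma)$ is the adjacency matrix and $D(\Gamma)$ the diagonal matrix of vertex degrees. All eigenvalues below are counted with algebraic multiplicity (spectra are multisets, so the multiplicities of coinciding values in a list add up, and an entry of multiplicity $0$ is absent). Then the $pq$ eigenvalues of $A_\alpha(\mathcal{P}(\mathcal{G}))$, all real, consist of $\alpha p-1$ with multiplicity $q(p-2)$, $\alpha q-1$ with multiplicity $q-2$, and the $q+2$ eigenvalues, all real, of the $(q+2)\times(q+2)$ matrix $$M=\begin{pmatrix} \alpha(pq-1) & (1-\alpha)(p-1) & (1-\alpha)(p-1) & \cdots & (1-\alpha)(p-1) & (1-\alpha)(q-1)\\ 1-\alpha & \alpha+p-2 & 0 & \cdots & 0 & 0\\ 1-\alpha & 0 & \alpha+p-2 & \cdots & 0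 & 0\\ \vdots & \vdots & \vdots & \ddots & \vdots & \vdots\\ 1-\alpha & 0 & 0 & \cdots & \alpha+p-2 & 0\\ 1-\alpha & 0 & 0 & \cdots & 0 & \alpha+q-2 \end{pmatrix},$$ in which the diagonal entry $\alpha+p-2$ occurs $q$ times. Moreover, the eigenvalues of $M$ consist of $\alpha+p-2$ with multiplicity $q-1$ and the three eigenvalues, all real, of $$\begin{pmatrix} \alpha(pq-1) & q(1-\alpha)(p-1) & (1-\alpha)(q-1)\\ 1-\alpha & \alpha+p-2 & 0\\ 1-\alpha & 0 & \alpha+q-2 \end{pmatrix}.$$ -/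

import Mathlib

/-- The undirected power graph of a group: distinct elements `x`, `y` are adjacent iff one of them
is a positive power of the other. -/
def powerGraph (G : Type*) [Group G] : SimpleGraph G where
  Adj x y := x ≠ y ∧ ((∃ i : ℕ, 0 < i ∧ x ^ i = y) ∨ (∃ j : ℕ, 0 < j ∧ y ^ j = x))
  symm := ⟨fun _ _ h => ⟨h.1.symm, h.2.symm⟩⟩
  loopless := ⟨fun _ h => h.1 rfl⟩

/-- The generalized adjacency matrix `A_α(Γ) = α D(Γ) + (1 - α) A(Γ)` of a simple graph. -/
noncomputable def alphaMatrix {V : Type*} [Fintype V] [DecidableEq V] (Γ : SimpleGraph V)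
    [DecidableRel Γ.Adj] (α : ℝ) : Matrix V V ℝ :=
  α • Γ.degMatrix ℝ + (1 - α) • Γ.adjMatrix ℝ

/-- The multiset of real eigenvalues of a real square matrix, repeated according to their
multiplicity as roots of the characteristic polynomial. -/
noncomputable def eigenvalueMultiset {n : Type*} [Fintype n] [DecidableEq n]
    (M : Matrix n n ℝ) : Multiset ℝ :=
  M.charpoly.roots

/-- The `(q+2) × (q+2)` quotient matrix, with rows and columns indexed by `0, 1, …, q, q + 1`. -/
noncomputable def quotientMatrix (α : ℝ) (p q : ℕ) : Matrix (Fin (q + 2)) (Fin (q + 2)) ℝ :=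
  Matrix.of fun i j =>
    if i = 0 then
      if j = 0 then α * ((p : ℝ) * q - 1)
      else if j = Fin.last (q + 1) then (1 - α) * ((q : ℝ) - 1)
      else (1 - α) * ((p : ℝ) - 1)
    else if j = 0 then 1 - α
    else if i = j then
      if i = Fin.last (q + 1) then α + (q : ℝ) - 2 else α + (p : ℝ) - 2
    else 0

/-- The reduced `3 × 3` matrix. -/
noncomputable def reducedMatrix (α : ℝ) (p q : ℕ) : Matrix (Fin 3) (Fin 3) ℝ :=
  !![α * ((p : ℝ) * q - 1), (q : ℝ) * (1 - α) * ((p : ℝ) - 1), (1 - α) * ((q : ℝ) - 1);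
     1 - α, α + (p : ℝ) - 2, 0;
     1 - α, 0, α + (q : ℝ) - 2]

/-! A nonabelian group of order `pq` is not cyclic, so every non-identity element has order `p` or
`q`. Two such elements are adjacent exactly when they are distinct and generate the same subgroup,
and the identity is adjacent to everything else. There is one subgroup of order `q` and there are
`q` of order `p`, so the power graph is a vertex joined to one clique on `q - 1` vertices and `q`
cliques on `p - 1` vertices.

Hence `A_α` is block-constant up to a diagonal constant on cells, and
`charpoly_eq_prod_mul_charpoly_quotient` splits its characteristic polynomial into explicit linear
factors and that of `M`. The same lemma, applied to `M` with its `q` equal middle indices merged,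
gives the `3 × 3` matrix. `A_α` is symmetric, so its roots are all real; counting them passes this
on to the two quotients, which need not be symmetric. -/

/-! ### Characteristic polynomials of block-constant matrices -/

open Polynomial in
/-- The characteristic polynomial of a matrix that is constant on the blocks of a partition, up to
a diagonal that is constant on the cells. -/
theorem charpoly_eq_prod_mul_charpoly_quotient {V I : Type*} [Fintype V] [DecidableEq V]
    [Fintype I] [DecidableEq I] (f : V → I) (d : I → ℝ) (B : Matrix I I ℝ) (n : I → ℕ)
    (hn : ∀ i, (Finset.univ.filter fun x => f x = i).card = n i) (hpos : ∀ i, 0 < n i)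
    (A : Matrix V V ℝ) (hA : ∀ x y, A x y = (if x = y then d (f x) else 0) + B (f x) (f y))
    (Q : Matrix I I ℝ) (hQ : ∀ i j, Q i j = (if i = j then d i else 0) + B i j * n j) :
    A.charpoly = (∏ i, (X - C (d i)) ^ (n i - 1)) * Q.charpoly := by
  apply Polynomial.eq_of_infinite_eval_eq
  -- Away from the finitely many values of `d`, the diagonal part of `t - A` is invertible and can
  -- be factored out.
  refine Set.Infinite.mono (s := (Set.range d)ᶜ) ?_ (Set.finite_range d).infinite_compl
  intro t ht
  have h0 : ∀ i, t - d i ≠ 0 := fun i h => ht ⟨i, by linarith⟩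
  let S : Matrix V I ℝ := Matrix.of fun x i => if f x = i then 1 else 0
  let e : I → ℝ := fun i => (t - d i)⁻¹
  have key : Matrix.scalar V t - A =
      Matrix.diagonal (fun x => t - d (f x)) *
        (1 - Matrix.diagonal (fun x => e (f x)) * S * (B * S.transpose)) := by
    have h1 : S * (B * S.transpose) = Matrix.of fun x y => B (f x) (f y) := by
      ext x y
      simp [S, Matrix.mul_apply]
    rw [Matrix.mul_assoc, h1]
    ext x y
    simp only [Matrix.sub_apply, Matrix.scalar_apply, Matrix.diagonal_mul, hA, Matrix.of_apply,
      Matrix.diagonal_apply, Matrix.one_apply, e]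
    have := h0 (f x)
    split_ifs <;> field_simp <;> ring
  have keyQ : Matrix.scalar I t - Q =
      (1 - B * S.transpose * (Matrix.diagonal (fun x => e (f x)) * S)) *
        Matrix.diagonal (fun i => t - d i) := by
    have h1 : S.transpose * (Matrix.diagonal (fun x => e (f x)) * S) =
        Matrix.diagonal fun i => n i * e i := by
      ext i j
      rw [Matrix.mul_apply]
      simp only [Matrix.transpose_apply, Matrix.diagonal_mul, S, Matrix.of_apply,
        Matrix.diagonal_apply]
      rw [← hn i]
      split_ifs with hij
      · subst hij
        rw [Finset.card_filter, Nat.cast_sum, Finset.sum_mul]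
        refine Finset.sum_congr rfl fun x _ => ?_
        by_cases h : f x = i <;> simp [h]
      · refine Finset.sum_eq_zero fun x _ => ?_
        by_cases h : f x = i
        · simp [h, hij]
        · simp [h]
    rw [Matrix.mul_assoc, h1]
    ext i j
    simp only [Matrix.sub_apply, Matrix.scalar_apply, Matrix.mul_diagonal, hQ,
      Matrix.diagonal_apply, Matrix.one_apply, e]
    have := h0 j
    split_ifs with h
    · subst h; field_simp; ring
    · field_simp; ring
  -- One factor per cell is set aside for the determinant of `t - Q`, whence the exponent `n i - 1`.
  have hdet : ∏ x, (t - d (f x)) = (∏ i, (t - d i) ^ (n i - 1)) * ∏ i, (t - d i) := by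
    rw [← Finset.prod_mul_distrib, ← Finset.prod_fiberwise Finset.univ f]
    refine Finset.prod_congr rfl fun i _ => ?_
    rw [← pow_succ, Nat.sub_add_cancel (hpos i), ← hn i]
    exact Finset.prod_eq_pow_card fun x hx => by rw [(Finset.mem_filter.1 hx).2]
  simp only [Set.mem_ofPred_eq, eval_mul, eval_prod, eval_pow, eval_sub, eval_X, eval_C,
    Matrix.eval_charpoly]
  -- The identity `det (1 - UV) = det (1 - VU)` passes from size `V` to size `I`.
  rw [key, keyQ, Matrix.det_mul, Matrix.det_mul, Matrix.det_one_sub_mul_comm, Matrix.det_diagonal,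
    Matrix.det_diagonal, hdet]
  ring

/-! ### Power graphs and cyclic subgroups of prime order -/

theorem zpowers_eq_of_mem_of_prime_orderOf {G : Type*} [Group G] {x y : G}
    (hx : (orderOf x).Prime) (hy : y ≠ 1) (h : y ∈ Subgroup.zpowers x) :
    Subgroup.zpowers y = Subgroup.zpowers x := by
  have hle : Subgroup.zpowers y ≤ Subgroup.zpowers x := Subgroup.zpowers_le.2 h
  have hfin : Finite (Subgroup.zpowers x) :=
    Nat.finite_of_card_ne_zero (by rw [Nat.card_zpowers]; exact hx.ne_zero)
  refine Subgroup.eq_of_le_of_card_ge hle ?_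
  rw [Nat.card_zpowers, Nat.card_zpowers]
  have hdvd : orderOf y ∣ orderOf x := by
    rw [← Nat.card_zpowers y, ← Nat.card_zpowers x]
    exact Subgroup.card_dvd_of_le hle
  rcases (Nat.dvd_prime hx).1 hdvd with h1 | h1
  · exact absurd (orderOf_eq_one_iff.1 h1) hy
  · exact h1.ge

theorem mem_zpowers_iff_eq_one_or_zpowers_eq {G : Type*} [Group G] {x y : G}
    (hx : (orderOf x).Prime) :
    y ∈ Subgroup.zpowers x ↔ y = 1 ∨ Subgroup.zpowers y = Subgroup.zpowers x := by
  constructor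
  · intro h
    by_cases hy : y = 1
    · exact Or.inl hy
    · exact Or.inr (zpowers_eq_of_mem_of_prime_orderOf hx hy h)
  · rintro (rfl | h)
    · exact one_mem _
    · rw [← h]
      exact Subgroup.mem_zpowers y

theorem exists_pos_pow_eq_iff_mem_zpowers {G : Type*} [Group G] [Finite G] (x y : G) :
    (∃ i : ℕ, 0 < i ∧ x ^ i = y) ↔ y ∈ Subgroup.zpowers x := by
  constructor
  · rintro ⟨i, -, rfl⟩
    exact Subgroup.npow_mem_zpowers x i
  · intro h
    obtain ⟨i, rfl⟩ := mem_powers_iff_mem_zpowers.2 h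
    -- The exponent `i` may be `0`; adding the order makes it positive.
    exact ⟨i + orderOf x, Nat.add_pos_right _ (orderOf_pos x),
      by simp [pow_add, pow_orderOf_eq_one]⟩

theorem powerGraph_adj_iff {G : Type*} [Group G] [Finite G] (x y : G) :
    (powerGraph G).Adj x y ↔
      x ≠ y ∧ (y ∈ Subgroup.zpowers x ∨ x ∈ Subgroup.zpowers y) := by
  rw [← exists_pos_pow_eq_iff_mem_zpowers, ← exists_pos_pow_eq_iff_mem_zpowers]
  rfl

theorem powerGraph_adj_iff_zpowers_eq {G : Type*} [Group G] [Finite G] {x y : G}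
    (hx : (orderOf x).Prime) (hy : (orderOf y).Prime) :
    (powerGraph G).Adj x y ↔ x ≠ y ∧ Subgroup.zpowers x = Subgroup.zpowers y := by
  have hx1 : x ≠ 1 := by
    rintro rfl
    exact Nat.not_prime_one (orderOf_one (G := G) ▸ hx)
  have hy1 : y ≠ 1 := by
    rintro rfl
    exact Nat.not_prime_one (orderOf_one (G := G) ▸ hy)
  rw [powerGraph_adj_iff, mem_zpowers_iff_eq_one_or_zpowers_eq hx,
    mem_zpowers_iff_eq_one_or_zpowers_eq hy]
  simp only [hx1, hy1, false_or, eq_comm (a := Subgroup.zpowers y), or_self]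

theorem powerGraph_degree_one {G : Type*} [Group G] [Fintype G] [DecidableEq G]
    [DecidableRel (powerGraph G).Adj] :
    (powerGraph G).degree 1 = Fintype.card G - 1 := by
  rw [← SimpleGraph.card_neighborFinset_eq_degree, ← Finset.card_univ,
    ← Finset.card_erase_of_mem (Finset.mem_univ (1 : G))]
  congr 1
  ext y
  simp [powerGraph_adj_iff, one_mem, eq_comm]

theorem card_filter_mem_zpowers {G : Type*} [Group G] [Fintype G]
    (x : G) [DecidablePred (· ∈ Subgroup.zpowers x)] :
    (Finset.univ.filter fun y => y ∈ Subgroup.zpowers x).card = orderOf x := by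
  rw [← Nat.card_zpowers, ← Fintype.card_subtype, Nat.card_eq_fintype_card]

open Classical in
theorem powerGraph_degree_of_prime_orderOf {G : Type*} [Group G] [Fintype G]
    [DecidableRel (powerGraph G).Adj] (hG : ∀ y : G, y ≠ 1 → (orderOf y).Prime)
    {x : G} (hx : x ≠ 1) :
    (powerGraph G).degree x = orderOf x - 1 := by
  rw [← SimpleGraph.card_neighborFinset_eq_degree, ← card_filter_mem_zpowers x,
    ← Finset.card_erase_of_mem (a := x) (by simp)]
  congr 1
  ext y
  simp only [SimpleGraph.mem_neighborFinset, Finset.mem_erase, Finset.mem_filter,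
    Finset.mem_univ, true_and]
  by_cases hy : y = 1
  · subst hy
    simp [powerGraph_adj_iff, one_mem, eq_comm]
  · rw [powerGraph_adj_iff_zpowers_eq (hG x hx) (hG y hy),
      mem_zpowers_iff_eq_one_or_zpowers_eq (hG x hx)]
    simp [hy, eq_comm]

open Classical in
theorem card_filter_zpowers_eq {G : Type*} [Group G] [Fintype G] {x : G}
    (hx : (orderOf x).Prime) :
    (Finset.univ.filter fun y => Subgroup.zpowers y = Subgroup.zpowers x).card =
      orderOf x - 1 := by
  rw [← card_filter_mem_zpowers x, ← Finset.card_erase_of_mem (a := 1) (by simp [one_mem])]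
  congr 1
  ext y
  simp only [Finset.mem_erase, Finset.mem_filter, Finset.mem_univ, true_and,
    mem_zpowers_iff_eq_one_or_zpowers_eq hx]
  have : Subgroup.zpowers y = Subgroup.zpowers x → y ≠ 1 := by
    rintro h rfl
    rw [← Nat.card_zpowers, ← h, Nat.card_zpowers, orderOf_one] at hx
    exact Nat.not_prime_one hx
  tauto

/-! ### Nonabelian groups of order `pq` -/

section

variable {G : Type*} [Group G] [Fintype G] {p q : ℕ}

theorem orderOf_eq_or_eq_of_ne_one (hp : p.Prime) (hq : q.Prime)
    (hcard : Fintype.card G = p * q) (hG : ∃ a b : G, a * b ≠ b * a) {x : G} (hx : x ≠ 1) :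
    orderOf x = p ∨ orderOf x = q := by
  have hdvd : orderOf x ∣ p * q := hcard ▸ orderOf_dvd_card
  obtain ⟨a, b, ha, hb, hab⟩ := exists_dvd_and_dvd_of_dvd_mul hdvd
  rcases (Nat.dvd_prime hp).1 ha with rfl | rfl <;> rcases (Nat.dvd_prime hq).1 hb with rfl | rfl
  · exact absurd (orderOf_eq_one_iff.1 (by simpa using hab)) hx
  · right; simpa using hab
  · left; simpa using hab
  · obtain ⟨c, d, hcd⟩ := hG
    have : IsCyclic G := isCyclic_of_orderOf_eq_card x (by
      rw [Nat.card_eq_fintype_card, hcard, hab])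
    exact absurd (IsCyclic.isMulCommutative.is_comm.comm c d) hcd

/-- The index of `⟨a⟩` is `p`, the least prime factor of the group order, so `⟨a⟩` is normal. The
image of `b` in the quotient has order dividing both `p` and `q`, hence is trivial. -/
theorem mem_zpowers_of_orderOf_eq_largest_prime (hp : p.Prime) (hq : q.Prime) (hpq : p < q)
    (hcard : Fintype.card G = p * q) {a b : G} (ha : orderOf a = q) (hb : orderOf b = q) :
    b ∈ Subgroup.zpowers a := by
  have hindex : (Subgroup.zpowers a).index = p := by
    have h := (Subgroup.zpowers a).card_mul_index
    rw [Nat.card_zpowers, ha, Nat.card_eq_fintype_card, hcard, mul_comm] at h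
    exact Nat.eq_of_mul_eq_mul_right hq.pos h
  have hnormal : (Subgroup.zpowers a).Normal := by
    apply Subgroup.normal_of_index_eq_minFac_card
    rw [hindex, Nat.card_eq_fintype_card, hcard]
    refine le_antisymm ?_ (Nat.minFac_le_of_dvd hp.two_le (dvd_mul_right p q))
    have hne : p * q ≠ 1 := fun h => hp.one_lt.ne' (Nat.eq_one_of_mul_eq_one_right h)
    have hm := Nat.minFac_prime hne
    rcases (Nat.Prime.dvd_mul hm).1 (Nat.minFac_dvd (p * q)) with h | h
    · exact ((Nat.prime_dvd_prime_iff_eq hm hp).1 h).ge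
    · exact hpq.le.trans ((Nat.prime_dvd_prime_iff_eq hm hq).1 h).ge
  rw [← QuotientGroup.eq_one_iff, ← orderOf_eq_one_iff]
  refine Nat.eq_one_of_dvd_coprimes ((Nat.coprime_primes hp hq).2 hpq.ne) ?_ ?_
  · have h := orderOf_dvd_natCard (b : G ⧸ Subgroup.zpowers a)
    rwa [← Subgroup.index, hindex] at h
  · rw [← hb]
    exact orderOf_map_dvd (QuotientGroup.mk' (Subgroup.zpowers a)) b

-- Counting elements by order suffices: with `m` subgroups of order `p`, `pq = 1 + (q - 1) + m(p -
-- 1)`, so `m = q`.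
open Classical in
theorem card_image_zpowers_orderOf_eq (hp : p.Prime) (hq : q.Prime) (hpq : p < q)
    (hcard : Fintype.card G = p * q) (hG : ∃ a b : G, a * b ≠ b * a) :
    ((Finset.univ.filter fun x : G => orderOf x = p).image Subgroup.zpowers).card = q := by
  obtain ⟨a, ha⟩ : ∃ a : G, orderOf a = q := by
    have := Fact.mk hq
    exact exists_prime_orderOf_dvd_card q (hcard ▸ dvd_mul_left q p)
  have hcq : (Finset.univ.filter fun x : G => orderOf x = q).card = q - 1 := by
    rw [← ha, ← card_filter_zpowers_eq (ha ▸ hq)]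
    congr 1
    ext b
    simp only [Finset.mem_filter, Finset.mem_univ, true_and]
    constructor
    · intro hb
      have hb1 : b ≠ 1 := by
        rintro rfl
        rw [orderOf_one, ha] at hb
        exact hq.one_lt.ne hb
      exact zpowers_eq_of_mem_of_prime_orderOf (ha ▸ hq) hb1
        (mem_zpowers_of_orderOf_eq_largest_prime hp hq hpq hcard ha (hb.trans ha))
    · intro h
      rw [← Nat.card_zpowers, h, Nat.card_zpowers]
  have hcp := Finset.card_eq_sum_card_image (Subgroup.zpowers (G := G))
    (Finset.univ.filter fun x : G => orderOf x = p)
  rw [Finset.sum_const_nat (m := p - 1)] at hcp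
  · have huniv : (Finset.univ : Finset G) =
        insert 1 ((Finset.univ.filter fun x : G => orderOf x = p) ∪
          (Finset.univ.filter fun x : G => orderOf x = q)) := by
      ext x
      by_cases hx : x = 1
      · simp [hx]
      · simpa [hx] using orderOf_eq_or_eq_of_ne_one hp hq hcard hG hx
    have hc := congrArg Finset.card huniv
    rw [Finset.card_univ, hcard, Finset.card_insert_of_notMem, Finset.card_union_of_disjoint, hcq,
      hcp] at hc
    · have hp1 := hp.one_lt
      obtain ⟨r, rfl⟩ : ∃ r, p = r + 2 := ⟨p - 2, by omega⟩
      obtain ⟨s, rfl⟩ : ∃ s, q = s + 1 := ⟨q - 1, by omega⟩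
      simp only [Nat.add_sub_cancel, show r + 2 - 1 = r + 1 by omega] at hc ⊢
      have : ((s + 1) * (r + 1)) =
        (Finset.image Subgroup.zpowers {x : G | orderOf x = r + 2}).card * (r + 1) := by linarith
      exact (Nat.eq_of_mul_eq_mul_right (Nat.succ_pos r) this).symm
    · rw [Finset.disjoint_filter]
      rintro x - h1 h2
      exact hpq.ne (h1.symm.trans h2)
    · simp [hp.one_lt.ne, hq.one_lt.ne]
  · intro H hH
    obtain ⟨x, hx, rfl⟩ := Finset.mem_image.1 hH
    have hxp : orderOf x = p := (Finset.mem_filter.1 hx).2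
    rw [← hxp, ← card_filter_zpowers_eq (hxp ▸ hp)]
    congr 1
    ext y
    simp only [Finset.mem_filter, Finset.mem_univ, true_and, and_iff_right_iff_imp]
    intro h
    rw [← Nat.card_zpowers, h, Nat.card_zpowers]
open Classical in
/-- A labelling of the elements by `0, …, q + 1`: the identity is labelled `0`, the elements of
order `q` are labelled `q + 1`, and the elements of order `p` are labelled by the subgroup that
they generate. -/
theorem exists_label (hp : p.Prime) (hq : q.Prime) (hpq : p < q)
    (hcard : Fintype.card G = p * q) (hG : ∃ a b : G, a * b ≠ b * a) :
    ∃ f : G → Fin (q + 2), (∀ x, f x = 0 ↔ x = 1) ∧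
      (∀ x, f x = Fin.last (q + 1) ↔ orderOf x = q) ∧
      (∀ x y, x ≠ 1 → y ≠ 1 → (f x = f y ↔ Subgroup.zpowers x = Subgroup.zpowers y)) ∧
      Function.Surjective f := by
  let T := (Finset.univ.filter fun x : G => orderOf x = p).image Subgroup.zpowers
  let e : T ≃ Fin q :=
    Finset.equivFinOfCardEq (card_image_zpowers_orderOf_eq hp hq hpq hcard hG)
  have hT : ∀ x : G, orderOf x = p → Subgroup.zpowers x ∈ T := fun x hx =>
    Finset.mem_image_of_mem _ (by simpa using hx)
  let f : G → Fin (q + 2) := fun x =>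
    if x = 1 then 0 else if h : orderOf x = p then (e ⟨_, hT x h⟩).castSucc.succ
      else Fin.last (q + 1)
  have hf1 : f 1 = 0 := if_pos rfl
  have ne_one : ∀ {x : G} {r : ℕ}, r.Prime → orderOf x = r → x ≠ 1 := by
    rintro x r hr h rfl
    exact hr.one_lt.ne (orderOf_one.symm.trans h)
  have hfp : ∀ x (h : orderOf x = p), f x = (e ⟨_, hT x h⟩).castSucc.succ := fun x h =>
    (if_neg (ne_one hp h)).trans (dif_pos h)
  have hfq : ∀ x, orderOf x = q → f x = (Fin.last q).succ := fun x h =>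
    (if_neg (ne_one hq h)).trans (dif_neg fun h' => hpq.ne (h'.symm.trans h))
  have hor : ∀ x : G, x ≠ 1 → orderOf x = p ∨ orderOf x = q := fun x hx =>
    orderOf_eq_or_eq_of_ne_one hp hq hcard hG hx
  have hqq : ∀ x y : G, orderOf x = q → orderOf y = q →
      Subgroup.zpowers x = Subgroup.zpowers y := fun x y hx hy =>
    zpowers_eq_of_mem_of_prime_orderOf (hy ▸ hq) (ne_one hq hx)
      (mem_zpowers_of_orderOf_eq_largest_prime hp hq hpq hcard hy hx)
  have hpq' : ∀ x y : G, orderOf x = p → orderOf y = q →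
      Subgroup.zpowers x ≠ Subgroup.zpowers y := fun x y hx hy h => by
    rw [← Nat.card_zpowers, h, Nat.card_zpowers, hy] at hx
    exact hpq.ne' hx
  refine ⟨f, fun x => ?_, fun x => ?_, fun x y hx hy => ?_, fun i => ?_⟩
  · by_cases hx : x = 1
    · simp [hx, hf1]
    · rcases hor x hx with h | h
      · simp [hfp x h, hx, Fin.succ_ne_zero]
      · simp [hfq x h, hx]
  · by_cases hx : x = 1
    · subst hx
      simp [hf1, hq.one_lt.ne, Fin.ext_iff]
    · rcases hor x hx with h | h
      · rw [hfp x h, ← Fin.succ_last, Fin.succ_inj, h]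
        simp [hpq.ne, Fin.castSucc_ne_last]
      · simp [hfq x h, h]
  · rcases hor x hx with hx | hx <;> rcases hor y hy with hy | hy
    · simp [hfp x hx, hfp y hy]
    · rw [hfp x hx, hfq y hy, Fin.succ_inj]
      simp [hpq' x y hx hy, Fin.castSucc_ne_last]
    · rw [hfq x hx, hfp y hy, Fin.succ_inj]
      simp [(hpq' y x hy hx).symm, (Fin.castSucc_ne_last _).symm]
    · simp [hfq x hx, hfq y hy, hqq x y hx hy]
  · refine Fin.cases ⟨1, hf1⟩ (fun j => ?_) i
    refine Fin.lastCases ?_ (fun k => ?_) j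
    · have := Fact.mk hq
      obtain ⟨a, ha⟩ := exists_prime_orderOf_dvd_card (G := G) q (hcard ▸ dvd_mul_left q p)
      exact ⟨a, hfq a ha⟩
    · obtain ⟨x, hx, hxk⟩ := Finset.mem_image.1 (e.symm k).2
      have hxp : orderOf x = p := (Finset.mem_filter.1 hx).2
      refine ⟨x, ?_⟩
      rw [hfp x hxp]
      congr 2
      rw [← e.apply_symm_apply k]
      exact congrArg e (Subtype.ext hxk)

/-! ### The two quotient steps -/

open Polynomial in
theorem charpoly_alphaMatrix_powerGraph [DecidableEq G] [DecidableRel (powerGraph G).Adj]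
    (hp : p.Prime) (hq : q.Prime) (hpq : p < q) (hcard : Fintype.card G = p * q)
    (hG : ∃ a b : G, a * b ≠ b * a) (α : ℝ) :
    (alphaMatrix (powerGraph G) α).charpoly =
      (X - C (α * (p : ℝ) - 1)) ^ (q * (p - 2)) * (X - C (α * (q : ℝ) - 1)) ^ (q - 2) *
        (quotientMatrix α p q).charpoly := by
  obtain ⟨f, hf0, hfl, hfz, hsurj⟩ := exists_label hp hq hpq hcard hG
  have hor : ∀ x : G, x ≠ 1 → orderOf x = p ∨ orderOf x = q := fun x hx =>
    orderOf_eq_or_eq_of_ne_one hp hq hcard hG hx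
  have hprime : ∀ x : G, x ≠ 1 → (orderOf x).Prime := fun x hx =>
    (hor x hx).elim (fun h => h ▸ hp) (fun h => h ▸ hq)
  have hp1 := hp.one_lt
  have hq1 := hq.one_lt
  -- In a clique cell `B` has diagonal entry `1 - α`, which must be subtracted from `α` times the
  -- degree: `α(q - 1) - (1 - α) = αq - 1`, and likewise for `p`. The identity is a single vertex,
  -- so its `B` entry can be `0`.
  let d : Fin (q + 2) → ℝ := fun i =>
    if i = 0 then α * ((p : ℝ) * q - 1)
    else if i = Fin.last (q + 1) then α * (q : ℝ) - 1 else α * (p : ℝ) - 1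
  let B : Matrix (Fin (q + 2)) (Fin (q + 2)) ℝ := Matrix.of fun i j =>
    if i = 0 then (if j = 0 then 0 else 1 - α) else if j = 0 then 1 - α
    else if i = j then 1 - α else 0
  let n : Fin (q + 2) → ℕ := fun i =>
    if i = 0 then 1 else if i = Fin.last (q + 1) then q - 1 else p - 1
  have hn : ∀ i, (Finset.univ.filter fun x => f x = i).card = n i := by
    intro i
    obtain ⟨x, rfl⟩ := hsurj i
    by_cases hx : x = 1
    · simp only [n, (hf0 x).2 hx, if_true, hf0]
      exact Finset.card_eq_one.2 ⟨1, by ext; simp⟩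
    · have hx0 : f x ≠ 0 := fun h => hx ((hf0 x).1 h)
      have hc : (Finset.univ.filter fun y => f y = f x).card = orderOf x - 1 := by
        classical
        rw [← card_filter_zpowers_eq (hprime x hx)]
        congr 1
        ext y
        simp only [Finset.mem_filter, Finset.mem_univ, true_and]
        by_cases hy : y = 1
        · refine iff_of_false (fun h => hx0 (h.symm.trans ((hf0 y).2 hy))) fun h => ?_
          rw [hy, Subgroup.zpowers_one_eq_bot, eq_comm, Subgroup.zpowers_eq_bot] at h
          exact hx h
        · exact hfz y x hy hx
      rw [hc]
      simp only [n, hx0, if_false, hfl]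
      split_ifs with h
      · rw [h]
      · rw [(hor x hx).resolve_right h]
  rw [charpoly_eq_prod_mul_charpoly_quotient f d B n hn ?_ _ ?_ (quotientMatrix α p q) ?_]
  · congr 1
    rw [Fin.prod_univ_succ, Fin.prod_univ_castSucc]
    have h1 : ∀ i : Fin q, n i.castSucc.succ = p - 1 := fun i => by
      simp [n, Fin.succ_ne_zero, ← Fin.succ_last, Fin.castSucc_ne_last]
    have h2 : ∀ i : Fin q, d i.castSucc.succ = α * (p : ℝ) - 1 := fun i => by
      simp [d, Fin.succ_ne_zero, ← Fin.succ_last, Fin.castSucc_ne_last]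
    have h3 : n (Fin.last q).succ = q - 1 := by simp [n]
    have h4 : d (Fin.last q).succ = α * (q : ℝ) - 1 := by simp [d]
    have h5 : n 0 = 1 := by simp [n]
    simp only [h1, h2, h3, h4, h5, Finset.prod_const, Finset.card_univ, Fintype.card_fin]
    rw [← pow_mul, mul_comm q, Nat.sub_sub, Nat.sub_sub]
    simp
  · intro i
    simp only [n]
    split_ifs <;> omega
  · intro x y
    have hA : alphaMatrix (powerGraph G) α x y =
        (if x = y then α * (powerGraph G).degree x else 0) +
          if (powerGraph G).Adj x y then 1 - α else 0 := by
      simp [alphaMatrix, SimpleGraph.degMatrix, Matrix.diagonal_apply, SimpleGraph.adjMatrix_apply]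
    rw [hA]
    simp only [d, B, Matrix.of_apply, hf0, hfl]
    by_cases hx : x = 1
    · subst hx
      by_cases hy : y = 1
      · subst hy
        have hpq1 : 1 ≤ p * q := Nat.mul_pos hp.pos hq.pos
        simp [powerGraph_degree_one, hcard, Nat.cast_sub hpq1]
      · have h1y : (1 : G) ≠ y := Ne.symm hy
        simp [hy, h1y, powerGraph_adj_iff, one_mem]
    · by_cases hy : y = 1
      · subst hy
        simp [hx, powerGraph_adj_iff, one_mem]
      · simp only [powerGraph_adj_iff_zpowers_eq (hprime x hx) (hprime y hy), ← hfz x y hx hy]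
        by_cases hxy : x = y
        · subst hxy
          rw [powerGraph_degree_of_prime_orderOf hprime hx]
          rcases hor x hx with h | h
          · simp [hx, h, hpq.ne, Nat.cast_sub hp.one_le]
            ring
          · simp [hx, h, Nat.cast_sub hq.one_le]
            ring
        · simp [hx, hy, hxy]
  · intro i j
    simp only [quotientMatrix, d, B, n, Matrix.of_apply]
    by_cases hi : i = 0
    · subst hi
      by_cases hj : j = 0
      · simp [hj]
      · have h0j : (0 : Fin (q + 2)) ≠ j := Ne.symm hj
        by_cases hl : j = Fin.last (q + 1)
        · simp [hl, Nat.cast_sub hq.one_le, Fin.ext_iff]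
        · simp [hj, h0j, hl, Nat.cast_sub hp.one_le]
    · by_cases hj : j = 0
      · simp [hi, hj]
      · by_cases hij : i = j
        · subst hij
          by_cases hl : i = Fin.last (q + 1)
          · simp [hl, Nat.cast_sub hq.one_le]
            ring
          · simp [hi, hl, Nat.cast_sub hp.one_le]
            ring
        · simp [hi, hj, hij]

end

-- The `q` indices of the order-`p` subgroups form one cell; since they do not interact, its
-- diagonal block in `B` is `0`.
open Polynomial in
theorem charpoly_quotientMatrix (α : ℝ) (p q : ℕ) (hq : 0 < q) :
    (quotientMatrix α p q).charpoly =
      (X - C (α + (p : ℝ) - 2)) ^ (q - 1) * (reducedMatrix α p q).charpoly := by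
  let f : Fin (q + 2) → Fin 3 := fun i =>
    if i = 0 then 0 else if i = Fin.last (q + 1) then 2 else 1
  let d : Fin 3 → ℝ := ![α * ((p : ℝ) * q - 1), α + (p : ℝ) - 2, α + (q : ℝ) - 2]
  let B : Matrix (Fin 3) (Fin 3) ℝ :=
    !![0, (1 - α) * ((p : ℝ) - 1), (1 - α) * ((q : ℝ) - 1); 1 - α, 0, 0; 1 - α, 0, 0]
  let n : Fin 3 → ℕ := ![1, q, 1]
  have hf0 : f 0 = 0 := by simp [f]
  have hf1 : ∀ i : Fin q, f i.castSucc.succ = 1 := fun i => by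
    simp [f, Fin.succ_ne_zero, ← Fin.succ_last, Fin.castSucc_ne_last]
  have hf2 : f (Fin.last q).succ = 2 := by simp [f]
  have hn : ∀ i, (Finset.univ.filter fun x => f x = i).card = n i := by
    intro i
    rw [Finset.card_filter, Fin.sum_univ_succ, Fin.sum_univ_castSucc]
    simp only [hf0, hf1, hf2]
    fin_cases i <;> simp [n]
  rw [charpoly_eq_prod_mul_charpoly_quotient f d B n hn ?_ _ ?_ (reducedMatrix α p q) ?_]
  · simp [Fin.prod_univ_three, d, n]
  · intro i
    fin_cases i <;> simp [n, hq]
  · intro i j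
    simp only [quotientMatrix, Matrix.of_apply, f]
    by_cases hi : i = 0
    · subst hi
      by_cases hj : j = 0
      · simp [hj, d, B]
      · have h0j : (0 : Fin (q + 2)) ≠ j := Ne.symm hj
        by_cases hl : j = Fin.last (q + 1)
        · simp [hl, B, Fin.ext_iff]
        · simp [hj, h0j, hl, B]
    · by_cases hj : j = 0
      · by_cases hl : i = Fin.last (q + 1) <;> simp [hi, hj, hl, B]
      · by_cases hij : i = j
        · subst hij
          by_cases hl : i = Fin.last (q + 1) <;> simp [hi, hl, d, B]
        · by_cases hl : i = Fin.last (q + 1) <;> by_cases hl' : j = Fin.last (q + 1) <;>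
            simp_all [B]
  · intro i j
    fin_cases i <;> fin_cases j <;> simp [reducedMatrix, d, B, n]
    ring

/-! ### Real eigenvalues and their count -/

theorem card_eigenvalueMultiset_alphaMatrix {V : Type*} [Fintype V] [DecidableEq V]
    (Γ : SimpleGraph V) [DecidableRel Γ.Adj] (α : ℝ) :
    (eigenvalueMultiset (alphaMatrix Γ α)).card = Fintype.card V := by
  have h : (alphaMatrix Γ α).IsHermitian := by
    ext x y
    by_cases hxy : x = y
    · simp [hxy]
    · simp [alphaMatrix, SimpleGraph.degMatrix, hxy, Ne.symm hxy,
        SimpleGraph.adjMatrix_apply, Γ.adj_comm]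
  simp [eigenvalueMultiset, h.roots_charpoly_eq_eigenvalues]

open Polynomial in
theorem roots_X_sub_C_pow_mul (a : ℝ) (k : ℕ) {r : ℝ[X]} (hr : r.Monic) :
    ((X - C a) ^ k * r).roots = Multiset.replicate k a + r.roots := by
  rw [Polynomial.roots_mul (((monic_X_sub_C a).pow k).mul hr).ne_zero, Polynomial.roots_pow,
    Polynomial.roots_X_sub_C, Multiset.nsmul_singleton]

theorem mainTheorem10 {G : Type*} [Group G] [Fintype G] [DecidableEq G]
    [DecidableRel (powerGraph G).Adj] (p q : ℕ) (hp : p.Prime) (hq : q.Prime) (hpq : p < q)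
    (hcard : Fintype.card G = p * q) (hG : ∃ a b : G, a * b ≠ b * a)
    (α : ℝ) (hα : α ∈ Set.Icc (0 : ℝ) 1) :
    eigenvalueMultiset (alphaMatrix (powerGraph G) α) =
        Multiset.replicate (q * (p - 2)) (α * (p : ℝ) - 1) +
          Multiset.replicate (q - 2) (α * (q : ℝ) - 1) +
          eigenvalueMultiset (quotientMatrix α p q) ∧
      eigenvalueMultiset (quotientMatrix α p q) =
        Multiset.replicate (q - 1) (α + (p : ℝ) - 2) +
          eigenvalueMultiset (reducedMatrix α p q) ∧
      (eigenvalueMultiset (alphaMatrix (powerGraph G) α)).card = p * q ∧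
      (eigenvalueMultiset (quotientMatrix α p q)).card = q + 2 ∧
      (eigenvalueMultiset (reducedMatrix α p q)).card = 3 := by
  have h1 : eigenvalueMultiset (alphaMatrix (powerGraph G) α) =
      Multiset.replicate (q * (p - 2)) (α * (p : ℝ) - 1) +
        Multiset.replicate (q - 2) (α * (q : ℝ) - 1) +
        eigenvalueMultiset (quotientMatrix α p q) := by
    have hm := (quotientMatrix α p q).charpoly_monic
    rw [eigenvalueMultiset, charpoly_alphaMatrix_powerGraph hp hq hpq hcard hG, mul_assoc,
      roots_X_sub_C_pow_mul _ _ (((Polynomial.monic_X_sub_C _).pow _).mul hm),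
      roots_X_sub_C_pow_mul _ _ hm, add_assoc]
    rfl
  have h2 : eigenvalueMultiset (quotientMatrix α p q) =
      Multiset.replicate (q - 1) (α + (p : ℝ) - 2) +
        eigenvalueMultiset (reducedMatrix α p q) := by
    rw [eigenvalueMultiset, charpoly_quotientMatrix α p q hq.pos,
      roots_X_sub_C_pow_mul _ _ (reducedMatrix α p q).charpoly_monic]
    rfl
  have h3 : (eigenvalueMultiset (alphaMatrix (powerGraph G) α)).card = p * q := by
    rw [card_eigenvalueMultiset_alphaMatrix, hcard]
  -- Since `q(p - 2) + (q - 2) + (q + 2) = pq`, the full count for `A_α` leaves exactly `q + 2` real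
  -- roots for `M`.
  have h4 : (eigenvalueMultiset (quotientMatrix α p q)).card = q + 2 := by
    have h := congrArg Multiset.card h1
    rw [h3] at h
    simp only [Multiset.card_add, Multiset.card_replicate] at h
    have hp2 := hp.two_le
    obtain ⟨r, rfl⟩ : ∃ r, p = r + 2 := ⟨p - 2, by omega⟩
    rw [Nat.add_sub_cancel, add_mul, mul_comm r q] at h
    omega
  have h5 : (eigenvalueMultiset (reducedMatrix α p q)).card = 3 := by
    have h := congrArg Multiset.card h2
    rw [h4] at h
    simp only [Multiset.card_add, Multiset.card_replicate] at h
    have := hq.pos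
    omega
  exact ⟨h1, h2, h3, h4, h5⟩
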